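/- Let $T=(V,E)$ be a free tree (a finite undirected tree) with $n=|V|$ vertices. A linear arrangement of $T$ is a bijection $\pi:V\to\{1,\dots,n\}$, and the length of an edge $uv$ in $\pi$ is $d_{uv}=|\pi(u)-\pi(v)|$. The arrangement $\pi$ is planar if no two edges $st$, $xy$ of $T$ cross, i.e. satisfy $\pi(s)<\pi(x)<\pi(t)<\pi(y)$ for some naming of their endpoints. For $r\in V$, let $T^r$ denote $T$ rooted at $r$; $\pi$ is a projective arrangement of $T^r$ if it is planar and no edge $st$ satisfies $\pi(s)<\pi(r)<\pi(t)$. Let $\mathbb{E}_{\mathrm{pl}}[d_{uv}]$ be the expected length of $uv$ in a uniformly random planar arrangement of $T$, and $\mathbb{E}_{\mathrm{pr}}^{(r)}[d_{uv}]$ its expected length in a uniformly random projective arrangement of $T^r$. For $x\in V$ let $n_r(x)$ be the number of vertices of the subtree of $T^r$ rooted at $x$, i.e. of those $w\in V$ such that $x$ lies on the path from $r$ to $w$. Then, for every edge $uv\in E$, $$\mathbb{E}_{\mathrm{pl}}[d_{uv}] = 1+\frac1n\sum_{r\in V\setminus\{u,v\}}\mathbb{E}_{\mathrm{pr}}^{(r)}[d_{uv}],$$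 and for every $r\in V$ $$\mathbb{E}_{\mathrm{pr}}^{(r)}[d_{uv}]=\frac{2\,n_r(c_r)+n_r(f_r)+1}{6},$$ where $c_r$ and $f_r$ are the endpoints of $uv$ closest to and farthest from $r$, respectively. -/

import Mathlib

/-- A linear arrangement of the `n` vertices: a bijection onto the positions. The positions
`1, …, n` are represented by `Fin n`, that is, shifted to `0, …, n - 1`; only the order of
positions and differences of positions are ever used. -/
abbrev Arrangement (V : Type*) [Fintype V] : Type _ := V ≃ Fin (Fintype.card V)

namespace Arrangement

variable {V : Type*} [Fintype V]

/-- The length `|π(u) - π(v)|` of the edge `uv` in the arrangement `π`. -/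
noncomputable def edgeLength (π : Arrangement V) (u v : V) : ℝ :=
  |((π u : ℕ) : ℝ) - ((π v : ℕ) : ℝ)|

/-- The arrangement `π` of the graph `G` is planar: no two edges `st`, `uv` of `G` cross,
i.e. satisfy `π(s) < π(u) < π(t) < π(v)` for some naming of their endpoints. -/
def IsPlanar (G : SimpleGraph V) (π : Arrangement V) : Prop :=
  ∀ s t u v : V, G.Adj s t → G.Adj u v → ¬ (π s < π u ∧ π u < π t ∧ π t < π v)

/-- The arrangement `π` of the tree `G` rooted at `r` is projective: it is planar and the root
is not covered by any edge. -/
def IsProjective (G : SimpleGraph V) (r : V) (π : Arrangement V) : Prop :=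
  IsPlanar G π ∧ ∀ s t : V, G.Adj s t → ¬ (π s < π r ∧ π r < π t)

end Arrangement

/-- The finite set of planar arrangements of `G`. -/
noncomputable def planarArrangements {V : Type*} [Fintype V] [DecidableEq V]
    (G : SimpleGraph V) : Finset (Arrangement V) :=
  open Classical in Finset.univ.filter fun π => π.IsPlanar G

/-- The finite set of projective arrangements of the tree `G` rooted at `r`. -/
noncomputable def projectiveArrangements {V : Type*} [Fintype V] [DecidableEq V]
    (G : SimpleGraph V) (r : V) : Finset (Arrangement V) :=
  open Classical in Finset.univ.filter fun π => π.IsProjective G r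

/-- The expected value of `X` over a uniformly random element of the finite set `S`. -/
noncomputable def uniformExpectation {α : Type*} (S : Finset α) (X : α → ℝ) : ℝ :=
  (∑ a ∈ S, X a) / (S.card : ℝ)

/-- Expected length of `uv` in uniformly random planar arrangements of `G`. -/
noncomputable def expectedLengthPlanar {V : Type*} [Fintype V] [DecidableEq V]
    (G : SimpleGraph V) (u v : V) : ℝ :=
  uniformExpectation (planarArrangements G) fun π => π.edgeLength u v

/-- Expected length of `uv` in uniformly random projective arrangements of `G` rooted at `r`. -/
noncomputable def expectedLengthProjective {V : Type*} [Fintype V] [DecidableEq V]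
    (G : SimpleGraph V) (r u v : V) : ℝ :=
  uniformExpectation (projectiveArrangements G r) fun π => π.edgeLength u v

/-- The vertices of the subtree hanging from `x` when the tree `G` is rooted at `r`: those `w`
for which `x` lies on the path from `r` to `w`. -/
def subtreeVertices {V : Type*} (G : SimpleGraph V) (r x : V) : Set V :=
  {w | ∃ p : G.Walk r w, p.IsPath ∧ x ∈ p.support}

/-- The directional size `n_r(x)`: the number of vertices of the subtree hanging from `x` when
`G` is rooted at `r`. -/
noncomputable def directionalSize {V : Type*} (G : SimpleGraph V) (r x : V) : ℕ :=
  (subtreeVertices G r x).ncard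

/-- The endpoint of the edge `uv` closest to `r`. (In a tree, the endpoints of an edge are
never at the same distance from `r`.) -/
noncomputable def closestEndpoint {V : Type*} (G : SimpleGraph V) (r u v : V) : V :=
  if G.dist r u < G.dist r v then u else v

/-- The endpoint of the edge `uv` farthest from `r`. -/
noncomputable def farthestEndpoint {V : Type*} (G : SimpleGraph V) (r u v : V) : V :=
  if G.dist r u < G.dist r v then v else u

/-! In a projective arrangement every subtree occupies consecutive positions, and conversely. Hence
exchanging two of the blocks `{c}`, `subtreeVertices G r g` (`g` a child of `c`) of a vertex `c` is
a symmetry of the set of projective arrangements. For a child `f` of `c`, a vertex strictly below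
`f` therefore lies between `c` and `f` with probability `1 / 2` (exchange its block with `f`), and a
vertex of another branch of `c` with probability `1 / 3` (its block, `c` and the block of `f` come
in any order equally often); no other vertex ever lies between them.

Rotating the positions cyclically preserves planarity, so each vertex comes first in equally many
planar arrangements, and those with `r` first are the projective arrangements of the tree rooted at
`r` in which `r` comes first. Away from the edges at `r` the same symmetries remain, so for `r`
outside the edge the expected length is the projective one. If `r` is an endpoint of the edge, the
probability `1 / 3` becomes `1 / 2` and the expected length is `n / 2`; the two endpoints together
contribute `n`, which is the summand `1`. -/

/-! ### Subtrees of a rooted tree -/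

section RootedTree

open SimpleGraph

variable {V : Type*} {G : SimpleGraph V} {r c f w x y z : V}

theorem mem_support_of_mem_subtreeVertices (hG : G.IsTree) (h : w ∈ subtreeVertices G r x)
    {p : G.Walk r w} (hp : p.IsPath) : x ∈ p.support := by
  obtain ⟨q, hq, hx⟩ := h
  rwa [(hG.existsUnique_path r w).unique hp hq]

theorem self_mem_subtreeVertices (hG : G.IsTree) (r x : V) : x ∈ subtreeVertices G r x :=
  let ⟨p, hp⟩ := (hG.existsUnique_path r x).exists
  ⟨p, hp, p.end_mem_support⟩

theorem mem_subtreeVertices_root (hG : G.IsTree) (r w : V) : w ∈ subtreeVertices G r r :=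
  let ⟨p, hp⟩ := (hG.existsUnique_path r w).exists
  ⟨p, hp, p.start_mem_support⟩

theorem directionalSize_root [Fintype V] (hG : G.IsTree) (r : V) :
    directionalSize G r r = Fintype.card V := by
  rw [directionalSize, Set.eq_univ_of_forall (mem_subtreeVertices_root hG r), Set.ncard_univ,
    Nat.card_eq_fintype_card]

theorem eq_of_root_mem_subtreeVertices (h : r ∈ subtreeVertices G r x) : x = r := by
  obtain ⟨p, hp, hx⟩ := h
  rw [(Walk.isPath_iff_nil.1 hp).eq_nil] at hx
  simpa using hx

theorem subtreeVertices_trans (hG : G.IsTree) (hy : y ∈ subtreeVertices G r x)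
    (hw : w ∈ subtreeVertices G r y) : w ∈ subtreeVertices G r x := by
  classical
  obtain ⟨p, hp, h⟩ := hw
  exact ⟨p, hp, p.support_takeUntil_subset_support h
    (mem_support_of_mem_subtreeVertices hG hy (hp.takeUntil h))⟩

theorem mem_subtreeVertices_iff_support_prefix (hG : G.IsTree) {p : G.Walk r x} (hp : p.IsPath)
    {q : G.Walk r w} (hq : q.IsPath) :
    w ∈ subtreeVertices G r x ↔ p.support <+: q.support := by
  classical
  refine ⟨fun h => ?_, fun h => ⟨q, hq, h.subset p.end_mem_support⟩⟩
  have hx := mem_support_of_mem_subtreeVertices hG h hq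
  rw [(hG.existsUnique_path r x).unique hp (hq.takeUntil hx)]
  exact q.support_takeUntil_prefix_support hx

theorem subtreeVertices_antisymm (hG : G.IsTree) (hy : y ∈ subtreeVertices G r x)
    (hx : x ∈ subtreeVertices G r y) : x = y := by
  classical
  obtain ⟨p, hp, h⟩ := hy
  by_contra hne
  exact Walk.endpoint_notMem_support_takeUntil hp h (Ne.symm hne)
    (mem_support_of_mem_subtreeVertices hG hx (hp.takeUntil h))

theorem mem_subtreeVertices_or_mem_of_mem_of_mem (hG : G.IsTree)
    (hx : w ∈ subtreeVertices G r x) (hy : w ∈ subtreeVertices G r y) :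
    y ∈ subtreeVertices G r x ∨ x ∈ subtreeVertices G r y := by
  classical
  obtain ⟨p, hp, h⟩ := hx
  have h' := mem_support_of_mem_subtreeVertices hG hy hp
  rcases List.prefix_or_prefix_of_prefix (p.support_takeUntil_prefix_support h)
    (p.support_takeUntil_prefix_support h') with hle | hle
  · exact Or.inl ⟨_, hp.takeUntil h', hle.subset (Walk.end_mem_support _)⟩
  · exact Or.inr ⟨_, hp.takeUntil h, hle.subset (Walk.end_mem_support _)⟩

theorem exists_walk_top_support_subset_subtreeVertices (h : w ∈ subtreeVertices G r x) :
    ∃ p : G.Walk x w, ∀ z ∈ p.support, z ∈ subtreeVertices G r x := by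
  classical
  obtain ⟨p, hp, hx⟩ := h
  refine ⟨p.dropUntil x hx, fun z hz =>
    ⟨(p.takeUntil x hx).append ((p.dropUntil x hx).takeUntil z hz), ?_, ?_⟩⟩
  · apply Walk.IsPath.of_append_left (q := (p.dropUntil x hx).dropUntil z hz)
    rwa [← Walk.append_assoc, Walk.take_spec, Walk.take_spec]
  · exact (Walk.mem_support_append_iff _ _).2 (Or.inl (Walk.end_mem_support _))

theorem exists_walk_support_subset_subtreeVertices (hx : x ∈ subtreeVertices G r z)
    (hy : y ∈ subtreeVertices G r z) :
    ∃ p : G.Walk x y, ∀ w ∈ p.support, w ∈ subtreeVertices G r z := by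
  obtain ⟨p, hp⟩ := exists_walk_top_support_subset_subtreeVertices hx
  obtain ⟨q, hq⟩ := exists_walk_top_support_subset_subtreeVertices hy
  refine ⟨p.reverse.append q, fun w hw => ?_⟩
  rw [Walk.mem_support_append_iff, Walk.support_reverse, List.mem_reverse] at hw
  exact hw.elim (hp w) (hq w)

theorem exists_walk_root_support_subset_compl_subtreeVertices (hG : G.IsTree)
    (h : w ∉ subtreeVertices G r x) :
    ∃ p : G.Walk r w, ∀ z ∈ p.support, z ∉ subtreeVertices G r x :=
  let ⟨p, hp⟩ := (hG.existsUnique_path r w).exists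
  ⟨p, fun _ hz hzx => h (subtreeVertices_trans hG hzx ⟨p, hp, hz⟩)⟩

theorem exists_adj_mem_notMem_of_walk (p : G.Walk x y) {S : Set V} (hx : x ∈ S) (hy : y ∉ S) :
    ∃ s ∈ p.support, ∃ t ∈ p.support, G.Adj s t ∧ s ∈ S ∧ t ∉ S :=
  let ⟨d, hd, hs, ht⟩ := p.exists_boundary_dart S hx hy
  ⟨d.fst, p.dart_fst_mem_support_of_mem_darts hd, d.snd, p.dart_snd_mem_support_of_mem_darts hd,
    d.adj, hs, ht⟩

/-- The vertex `f` is a child of `c` in the tree `G` rooted at `r`. -/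
def IsChild (G : SimpleGraph V) (r c f : V) : Prop :=
  G.Adj c f ∧ f ∈ subtreeVertices G r c

theorem isChild_or_isChild_of_adj (hG : G.IsTree) (r : V) (h : G.Adj x y) :
    IsChild G r x y ∨ IsChild G r y x := by
  obtain ⟨p, hp⟩ := (hG.existsUnique_path r x).exists
  by_cases hy : y ∈ p.support
  · exact Or.inr ⟨h.symm, p, hp, hy⟩
  · exact Or.inl ⟨h, p.concat h, hp.concat hy h, by simp [Walk.support_concat]⟩

namespace IsChild

theorem ne (h : IsChild G r c f) : c ≠ f := h.1.ne

theorem notMem_subtreeVertices (hG : G.IsTree) (h : IsChild G r c f) :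
    c ∉ subtreeVertices G r f :=
  fun hc => h.ne (subtreeVertices_antisymm hG h.2 hc)

theorem ne_root (h : IsChild G r c f) : f ≠ r := by
  rintro rfl
  exact h.ne (eq_of_root_mem_subtreeVertices h.2)

theorem eq_or_mem_subtreeVertices (hG : G.IsTree) (h : IsChild G r c f)
    (hz : f ∈ subtreeVertices G r z) : z = f ∨ c ∈ subtreeVertices G r z := by
  obtain ⟨p, hp⟩ := (hG.existsUnique_path r c).exists
  have hfp : f ∉ p.support := fun hf => h.notMem_subtreeVertices hG ⟨p, hp, hf⟩
  have hz := mem_support_of_mem_subtreeVertices hG hz (hp.concat hfp h.1)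
  rw [Walk.support_concat, List.mem_append, List.mem_singleton] at hz
  exact hz.symm.imp_right fun hzp => ⟨p, hp, hzp⟩

theorem disjoint_subtreeVertices (hG : G.IsTree) (hx : IsChild G r c x) (hy : IsChild G r c y)
    (hne : x ≠ y) : Disjoint (subtreeVertices G r x) (subtreeVertices G r y) := by
  rw [Set.disjoint_left]
  intro w hwx hwy
  rcases mem_subtreeVertices_or_mem_of_mem_of_mem hG hwx hwy with h | h
  · exact (hy.eq_or_mem_subtreeVertices hG h).elim hne (hx.notMem_subtreeVertices hG)
  · exact (hx.eq_or_mem_subtreeVertices hG h).elim hne.symm (hy.notMem_subtreeVertices hG)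

theorem dist_lt_dist (hG : G.IsTree) (h : IsChild G r c f) : G.dist r c < G.dist r f := by
  classical
  obtain ⟨p, hp, hlength⟩ := hG.connected.exists_path_of_dist r f
  have hc := mem_support_of_mem_subtreeVertices hG h.2 hp
  calc G.dist r c ≤ (p.takeUntil c hc).length := dist_le _
    _ < p.length := p.length_takeUntil_lt_length hc h.ne
    _ = G.dist r f := hlength

end IsChild

theorem isChild_closestEndpoint_farthestEndpoint (hG : G.IsTree) (r : V) (h : G.Adj x y) :
    IsChild G r (closestEndpoint G r x y) (farthestEndpoint G r x y) := by
  rw [closestEndpoint, farthestEndpoint]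
  rcases isChild_or_isChild_of_adj hG r h with hxy | hyx
  · simpa [hxy.dist_lt_dist hG] using hxy
  · simpa [(hyx.dist_lt_dist hG).not_gt] using hyx

theorem exists_upper_endpoint_of_adj (hG : G.IsTree) (r : V) (h : G.Adj x y) :
    ∃ c, (c = x ∨ c = y) ∧ x ∈ subtreeVertices G r c ∧ y ∈ subtreeVertices G r c ∧
      ∀ z, z ≠ x → z ≠ y → x ∈ subtreeVertices G r z ∨ y ∈ subtreeVertices G r z →
        c ∈ subtreeVertices G r z := by
  wlog hxy : IsChild G r x y generalizing x y
  · obtain ⟨c, hc, hy, hx, hz⟩ := this h.symm ((isChild_or_isChild_of_adj hG r h).resolve_left hxy)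
    exact ⟨c, hc.symm, hx, hy, fun z hzx hzy hxy => hz z hzy hzx hxy.symm⟩
  · exact ⟨x, Or.inl rfl, self_mem_subtreeVertices hG r x, hxy.2, fun z _ hzy hz =>
      hz.elim id fun hyz => (hxy.eq_or_mem_subtreeVertices hG hyz).resolve_left hzy⟩

theorem exists_isChild_of_mem_subtreeVertices (hG : G.IsTree) (hw : w ∈ subtreeVertices G r c)
    (hne : w ≠ c) : ∃ g, IsChild G r c g ∧ w ∈ subtreeVertices G r g := by
  classical
  obtain ⟨p, hp, hc⟩ := hw
  have hnil : ¬ (p.dropUntil c hc).Nil := Walk.not_nil_of_ne hne.symm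
  set g := (p.dropUntil c hc).snd
  have hadj : G.Adj c g := Walk.adj_snd hnil
  have hg : g ∈ (p.dropUntil c hc).support.tail := (p.dropUntil c hc).snd_mem_tail_support hnil
  have hgp : g ∈ p.support :=
    p.support_dropUntil_subset_support hc (List.mem_of_mem_tail hg)
  refine ⟨g, ?_, p, hp, hgp⟩
  refine (isChild_or_isChild_of_adj hG r hadj).resolve_right fun hgc => ?_
  have hg' := mem_support_of_mem_subtreeVertices hG hgc.2 (hp.takeUntil hc)
  have hnodup := hp.support_nodup
  rw [← p.take_spec hc, Walk.support_append] at hnodup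
  exact List.disjoint_of_nodup_append hnodup hg' hg

end RootedTree

theorem ordConnected_setOf_prefix {α : Type*} [LinearOrder α] (p : List α) :
    {l | p <+: l}.OrdConnected := by
  refine Set.ordConnected_of_Ioo ?_
  induction p with
  | nil => exact fun _ _ _ _ _ _ _ => List.nil_prefix
  | cons i p ih =>
    rintro _ ⟨a, rfl⟩ _ ⟨b, rfl⟩ - (_ | ⟨j, l⟩) ⟨hal, hlb⟩
    · exact absurd hal (List.not_lt_nil _)
    · rw [List.cons_append, List.cons_lt_cons_iff] at hal hlb
      obtain rfl : i = j := by grind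
      have hal' := (hal.resolve_left (lt_irrefl _)).2
      have hlb' := (hlb.resolve_left (lt_irrefl _)).2
      exact List.cons_prefix_cons.2 ⟨rfl, ih _ (List.prefix_append p a) _
        (List.prefix_append p b) (hal'.trans hlb') ⟨hal', hlb'⟩⟩

namespace Arrangement

/-! ### Blocks of consecutive positions -/

section Blocks

variable {V : Type*} [Fintype V] {π ρ : Arrangement V} {A : Set V} {a b m n v w : V}

theorem lt_or_lt_of_ne (π : Arrangement V) (h : v ≠ w) : π v < π w ∨ π w < π v :=
  lt_or_gt_of_ne (π.injective.ne h)

theorem ext_of_lt_imp_lt (h : ∀ v w, π v < π w → ρ v < ρ w) : π = ρ := by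
  have hmono : StrictMono (π.symm.trans ρ) := fun i j hij => h _ _ (by simpa using hij)
  have hrefl : hmono.orderIsoOfSurjective _ (π.symm.trans ρ).surjective = OrderIso.refl _ :=
    Subsingleton.elim _ _
  refine Equiv.ext fun v => ?_
  simpa using (DFunLike.congr_fun hrefl (π v)).symm

/-- The arrangement of the vertices in increasing order of an injective key. -/
noncomputable def sortBy {α : Type*} [LinearOrder α] (k : V → α) (hk : Function.Injective k) :
    Arrangement V :=
  letI := LinearOrder.lift' k hk
  (Fintype.orderIsoFinOfCardEq V rfl).symm.toEquiv

theorem sortBy_lt_sortBy_iff {α : Type*} [LinearOrder α] {k : V → α}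
    {hk : Function.Injective k} : sortBy k hk v < sortBy k hk w ↔ k v < k w :=
  letI := LinearOrder.lift' k hk
  (Fintype.orderIsoFinOfCardEq V rfl).symm.lt_iff_lt

theorem injective_toLex_prod {α : Type*} (π : Arrangement V) (f : V → α) :
    Function.Injective fun v => toLex (f v, π v) :=
  fun v w h => by simpa using congrArg (fun p => (ofLex p).2) h

/-- The vertices of `A` occupy consecutive positions in `π`. -/
def IsBlock (π : Arrangement V) (A : Set V) : Prop :=
  (π '' A).OrdConnected

theorem isBlock_iff : π.IsBlock A ↔ ∀ a ∈ A, ∀ b ∈ A, ∀ w ∉ A, π a < π w → π b < π w := by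
  constructor
  · intro h a ha b hb w hw haw
    by_contra hwb
    obtain ⟨w', hw', heq⟩ := h.out (Set.mem_image_of_mem π ha) (Set.mem_image_of_mem π hb)
      ⟨haw.le, not_lt.1 hwb⟩
    exact hw (π.injective heq ▸ hw')
  · intro h
    refine Set.ordConnected_of_Ioo ?_
    rintro _ ⟨a, ha, rfl⟩ _ ⟨b, hb, rfl⟩ - i ⟨hai, hib⟩
    refine ⟨π.symm i, by_contra fun hi => ?_, π.apply_symm_apply i⟩
    exact (h a ha b hb _ hi (by simpa using hai)).not_gt (by simpa using hib)

theorem isBlock_sortBy {α : Type*} [LinearOrder α] {k : V → α} {hk : Function.Injective k}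
    {S : Set α} (hS : S.OrdConnected) : (sortBy k hk).IsBlock (k ⁻¹' S) := by
  refine isBlock_iff.2 fun a ha b hb w hw haw => ?_
  rw [sortBy_lt_sortBy_iff] at haw ⊢
  by_contra hwb
  exact hw (hS.out ha hb ⟨haw.le, not_lt.1 hwb⟩)

theorem isBlock_of_subsingleton (hA : A.Subsingleton) : π.IsBlock A :=
  isBlock_iff.2 fun _ ha _ hb _ _ h => hA ha hb ▸ h

namespace IsBlock

theorem lt_iff_lt (h : π.IsBlock A) (ha : a ∈ A) (hb : b ∈ A) (hw : w ∉ A) :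
    π a < π w ↔ π b < π w :=
  ⟨isBlock_iff.1 h a ha b hb w hw, isBlock_iff.1 h b hb a ha w hw⟩

theorem lt_iff_lt' (h : π.IsBlock A) (ha : a ∈ A) (hb : b ∈ A) (hw : w ∉ A) :
    π w < π a ↔ π w < π b := by
  have hne {x : V} (hx : x ∈ A) : π w ≠ π x := π.injective.ne (ne_of_mem_of_not_mem hx hw).symm
  rw [← (hne ha).le_iff_lt, ← (hne hb).le_iff_lt, ← not_lt, ← not_lt, h.lt_iff_lt ha hb hw]

theorem mem_of_lt_of_lt (h : π.IsBlock A) (ha : a ∈ A) (hb : b ∈ A) (haw : π a < π w)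
    (hwb : π w < π b) : w ∈ A :=
  by_contra fun hw => ((h.lt_iff_lt ha hb hw).1 haw).not_gt hwb

end IsBlock

/-- The vertex `m` is placed strictly between `a` and `b`, in either order. -/
def Between (π : Arrangement V) (a m b : V) : Prop :=
  (π a < π m ∧ π m < π b) ∨ (π b < π m ∧ π m < π a)

instance (π : Arrangement V) (a m b : V) : Decidable (π.Between a m b) :=
  inferInstanceAs (Decidable (_ ∨ _))

theorem between_comm : π.Between a m b ↔ π.Between b m a :=
  Or.comm

theorem IsBlock.between_iff (h : π.IsBlock A) (hm : m ∈ A) (hn : n ∈ A) (ha : a ∉ A)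
    (hb : b ∉ A) : π.Between a m b ↔ π.Between a n b := by
  simp only [Between, h.lt_iff_lt hm hn ha, h.lt_iff_lt hm hn hb, h.lt_iff_lt' hm hn ha,
    h.lt_iff_lt' hm hn hb]

theorem IsBlock.not_between (h : π.IsBlock A) (ha : a ∈ A) (hb : b ∈ A) (hm : m ∉ A) :
    ¬ π.Between a m b := by
  rintro (⟨h₁, h₂⟩ | ⟨h₁, h₂⟩)
  · exact hm (h.mem_of_lt_of_lt ha hb h₁ h₂)
  · exact hm (h.mem_of_lt_of_lt hb ha h₁ h₂)

theorem rep_lt_rep_of_lt {rep : V → V} (hrep : ∀ v, rep (rep v) = rep v)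
    (hblock : ∀ z, π.IsBlock (rep ⁻¹' {z})) (hne : rep v ≠ rep w) (h : π v < π w) :
    π (rep v) < π (rep w) :=
  ((hblock (rep w)).lt_iff_lt' rfl (hrep w) ((hrep v).trans_ne hne)).1
    (((hblock (rep v)).lt_iff_lt rfl (hrep v) hne.symm).1 h)

theorem edgeLength_comm (π : Arrangement V) (v w : V) : π.edgeLength v w = π.edgeLength w v :=
  abs_sub_comm _ _

theorem edgeLength_eq_one_add_card_between (π : Arrangement V) (h : v ≠ w) :
    π.edgeLength v w = 1 + (Finset.card {m | π.Between v m w} : ℝ) := by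
  wlog hvw : π v < π w generalizing v w
  · rw [edgeLength_comm, this h.symm ((π.lt_or_lt_of_ne h).resolve_left hvw)]
    simp only [between_comm]
  have himage : Finset.map π.toEmbedding {m | π.Between v m w} = Finset.Ioo (π v) (π w) := by
    ext i
    rw [Finset.mem_map_equiv, Finset.mem_filter_univ, Finset.mem_Ioo, Between,
      Equiv.apply_symm_apply, or_iff_left_iff_imp]
    exact fun hi => absurd (hi.1.trans hi.2) hvw.not_gt
  have hsucc : (π v : ℕ) + 1 ≤ π w := hvw
  rw [← Finset.card_map π.toEmbedding, himage, Fin.card_Ioo, Nat.sub_sub, Nat.cast_sub hsucc,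
    edgeLength, abs_sub_comm, abs_of_nonneg (sub_nonneg.2 (by exact_mod_cast hvw.le))]
  push_cast
  ring

/-- The vertex `r` comes first in `π`. -/
def IsFirst (π : Arrangement V) (r : V) : Prop :=
  ∀ w, w ≠ r → π r < π w

theorem isFirst_iff_eq_zero [NeZero (Fintype.card V)] {r : V} : π.IsFirst r ↔ π r = 0 := by
  constructor
  · intro h
    by_contra hr
    have hlt := h (π.symm 0) fun e => hr (by rw [← e, Equiv.apply_symm_apply])
    simp at hlt
  · intro h w hw
    exact h ▸ Fin.pos_iff_ne_zero.2 (h ▸ π.injective.ne hw)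

end Blocks

section SwapBlocks

variable {V : Type*} [Fintype V] [DecidableEq V] {π : Arrangement V} {rep : V → V} {S : Set V}
  {x y v w : V}

/-- The arrangement obtained from `π` by letting the blocks `rep ⁻¹' {x}` and `rep ⁻¹' {y}` trade
places. Here the fibres of `rep` are consecutive blocks of `π`, represented by the fixed points of
`rep`; the blocks are sorted by the positions of their exchanged representatives, and the vertices
within a block keep their order. -/
noncomputable def swapBlocks (π : Arrangement V) (rep : V → V) (x y : V) : Arrangement V :=
  sortBy _ (π.injective_toLex_prod fun v => π (Equiv.swap x y (rep v)))

theorem swapBlocks_lt_iff : π.swapBlocks rep x y v < π.swapBlocks rep x y w ↔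
    π (Equiv.swap x y (rep v)) < π (Equiv.swap x y (rep w)) ∨ rep v = rep w ∧ π v < π w := by
  rw [swapBlocks, sortBy_lt_sortBy_iff, Prod.Lex.toLex_lt_toLex]
  simp only [EmbeddingLike.apply_eq_iff_eq]

theorem swapBlocks_lt_iff_of_rep_eq_self (hv : rep v = v) (hw : rep w = w) :
    π.swapBlocks rep x y v < π.swapBlocks rep x y w ↔
      π (Equiv.swap x y v) < π (Equiv.swap x y w) := by
  rw [swapBlocks_lt_iff, hv, hw, or_iff_left]
  rintro ⟨rfl, h⟩
  exact h.false

theorem swapBlocks_between_iff {a m b : V} (ha : rep a = a) (hm : rep m = m) (hb : rep b = b) :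
    (π.swapBlocks rep x y).Between a m b ↔
      π.Between (Equiv.swap x y a) (Equiv.swap x y m) (Equiv.swap x y b) := by
  simp only [Between, swapBlocks_lt_iff_of_rep_eq_self, ha, hm, hb]

theorem swapBlocks_swapBlocks (hrep : ∀ v, rep (rep v) = rep v)
    (hblock : ∀ z, π.IsBlock (rep ⁻¹' {z})) (hx : rep x = x) (hy : rep y = y) :
    (π.swapBlocks rep x y).swapBlocks rep x y = π := by
  refine (ext_of_lt_imp_lt fun v w h => ?_).symm
  have hswap (v : V) : rep (Equiv.swap x y (rep v)) = Equiv.swap x y (rep v) := by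
    rw [Equiv.swap_apply_def]
    split_ifs
    exacts [hy, hx, hrep v]
  rw [swapBlocks_lt_iff, swapBlocks_lt_iff_of_rep_eq_self (hswap v) (hswap w),
    Equiv.swap_apply_self, Equiv.swap_apply_self]
  by_cases hvw : rep v = rep w
  · exact Or.inr ⟨hvw, swapBlocks_lt_iff.2 (Or.inr ⟨hvw, h⟩)⟩
  · exact Or.inl (rep_lt_rep_of_lt hrep hblock hvw h)

theorem IsBlock.swapBlocks_of_subset_fiber (hS : π.IsBlock S) (h : S ⊆ rep ⁻¹' {v}) :
    (π.swapBlocks rep x y).IsBlock S := by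
  refine isBlock_iff.2 fun a ha b hb w hw => ?_
  rw [swapBlocks_lt_iff, swapBlocks_lt_iff, h ha, h hb, hS.lt_iff_lt ha hb hw]
  exact id

theorem IsBlock.swapBlocks_of_invariant (hS : π.IsBlock S)
    (h : ∀ w, Equiv.swap x y (rep w) ∈ S ↔ w ∈ S) : (π.swapBlocks rep x y).IsBlock S := by
  refine isBlock_iff.2 fun a ha b hb w hw => ?_
  have hne {a : V} (ha : a ∈ S) : rep a ≠ rep w := fun e => hw ((h w).1 (e ▸ (h a).2 ha))
  rw [swapBlocks_lt_iff, swapBlocks_lt_iff, or_iff_left fun e => hne ha e.1,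
    or_iff_left fun e => hne hb e.1]
  exact (hS.lt_iff_lt ((h a).2 ha) ((h b).2 hb) (mt (h w).1 hw)).1

theorem IsFirst.swapBlocks {r : V} (hr : π.IsFirst r) (hrep : ∀ v, rep v = r ↔ v = r)
    (hx : x ≠ r) (hy : y ≠ r) : (π.swapBlocks rep x y).IsFirst r := by
  intro w hw
  rw [swapBlocks_lt_iff, (hrep r).2 rfl, Equiv.swap_apply_of_ne_of_ne hx.symm hy.symm]
  refine Or.inl (hr _ ?_)
  rw [Ne, Equiv.swap_apply_eq_iff, Equiv.swap_apply_of_ne_of_ne hx.symm hy.symm, hrep]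
  exact hw

end SwapBlocks

end Arrangement

/-! ### Exchanging the branches at a vertex -/

section Branches

open SimpleGraph

variable {V : Type*} {G : SimpleGraph V} {r c g w x y z : V}

/-- The vertex `c` together with its children: the vertices representing the blocks `{c}` and
`subtreeVertices G r g`, for `g` a child of `c`, into which the subtree hanging from `c` splits. -/
def branchRoots (G : SimpleGraph V) (r c : V) : Set V :=
  insert c {g | IsChild G r c g}

theorem branchRoots_subset_subtreeVertices (hG : G.IsTree) :
    branchRoots G r c ⊆ subtreeVertices G r c :=
  Set.insert_subset (self_mem_subtreeVertices hG r c) fun _ => And.right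

theorem ne_root_of_mem_branchRoots (hG : G.IsTree) (hx : x ∈ branchRoots G r c)
    (hc : c ≠ r) : x ≠ r :=
  fun h => hc (eq_of_root_mem_subtreeVertices (h ▸ branchRoots_subset_subtreeVertices hG hx))

open Classical in
/-- The representative of `w` when the subtrees hanging from the children of `c` are collapsed:
the child of `c` above `w` if there is one, and `w` itself otherwise. In particular, `c` and its
children represent themselves. -/
noncomputable def branchRep (G : SimpleGraph V) (r c w : V) : V :=
  if h : ∃ g, IsChild G r c g ∧ w ∈ subtreeVertices G r g then h.choose else w

theorem branchRep_eq_of_mem (hG : G.IsTree) (hg : IsChild G r c g)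
    (hw : w ∈ subtreeVertices G r g) : branchRep G r c w = g := by
  have h : ∃ g, IsChild G r c g ∧ w ∈ subtreeVertices G r g := ⟨g, hg, hw⟩
  rw [branchRep, dif_pos h]
  by_contra hne
  exact Set.disjoint_left.1 (h.choose_spec.1.disjoint_subtreeVertices hG hg hne)
    h.choose_spec.2 hw

theorem branchRep_eq_self_of_forall_notMem
    (h : ∀ g, IsChild G r c g → w ∉ subtreeVertices G r g) : branchRep G r c w = w :=
  dif_neg fun ⟨g, hg, hw⟩ => h g hg hw

theorem branchRep_eq_self_of_notMem (hG : G.IsTree) (hw : w ∉ subtreeVertices G r c) :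
    branchRep G r c w = w :=
  branchRep_eq_self_of_forall_notMem fun _ hg hwg => hw (subtreeVertices_trans hG hg.2 hwg)

theorem branchRep_eq_self (hG : G.IsTree) (hx : x ∈ branchRoots G r c) :
    branchRep G r c x = x := by
  rcases hx with rfl | hx
  · exact branchRep_eq_self_of_forall_notMem fun g hg => hg.notMem_subtreeVertices hG
  · exact branchRep_eq_of_mem hG hx (self_mem_subtreeVertices hG r x)

theorem isChild_branchRep_or_eq_self (G : SimpleGraph V) (r c w : V) :
    IsChild G r c (branchRep G r c w) ∧ w ∈ subtreeVertices G r (branchRep G r c w) ∨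
      branchRep G r c w = w := by
  rw [branchRep]
  split_ifs with h
  exacts [Or.inl h.choose_spec, Or.inr rfl]

theorem branchRep_branchRep (hG : G.IsTree) (r c w : V) :
    branchRep G r c (branchRep G r c w) = branchRep G r c w := by
  rcases isChild_branchRep_or_eq_self G r c w with h | h
  · exact branchRep_eq_self hG (Or.inr h.1)
  · rw [h, h]

theorem mem_subtreeVertices_branchRep (hG : G.IsTree) (r c w : V) :
    w ∈ subtreeVertices G r (branchRep G r c w) := by
  rcases isChild_branchRep_or_eq_self G r c w with h | h
  · exact h.2
  · rw [h]
    exact self_mem_subtreeVertices hG r w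

theorem branchRep_mem_subtreeVertices_iff (hG : G.IsTree) :
    branchRep G r c w ∈ subtreeVertices G r c ↔ w ∈ subtreeVertices G r c := by
  rcases isChild_branchRep_or_eq_self G r c w with h | h
  · exact iff_of_true h.1.2 (subtreeVertices_trans hG h.1.2 h.2)
  · rw [h]

theorem branchRep_eq_root_iff : branchRep G r c w = r ↔ w = r := by
  constructor
  · intro h
    exact (isChild_branchRep_or_eq_self G r c w).elim (fun hw => absurd h hw.1.ne_root)
      fun hw => hw.symm.trans h
  · rintro rfl
    exact branchRep_eq_self_of_forall_notMem fun g hg hr =>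
      hg.ne_root (eq_of_root_mem_subtreeVertices hr)

theorem preimage_branchRep_singleton (hG : G.IsTree) (z : V) :
    branchRep G r c ⁻¹' {z} = subtreeVertices G r z ∨
      (branchRep G r c ⁻¹' {z}).Subsingleton := by
  by_cases hz : IsChild G r c z
  · refine Or.inl (Set.ext fun w => ⟨?_, branchRep_eq_of_mem hG hz⟩)
    rintro rfl
    exact mem_subtreeVertices_branchRep hG r c w
  · refine Or.inr (Set.subsingleton_of_subset_singleton (a := z) ?_)
    rintro w rfl
    exact ((isChild_branchRep_or_eq_self G r c w).resolve_left fun h => hz h.1).symm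

theorem swap_branchRep_mem_iff [DecidableEq V] (hG : G.IsTree) {S : Set V}
    (hS : subtreeVertices G r c ⊆ S ∨ Disjoint (subtreeVertices G r c) S)
    (hx : x ∈ subtreeVertices G r c) (hy : y ∈ subtreeVertices G r c) :
    Equiv.swap x y (branchRep G r c w) ∈ S ↔ w ∈ S := by
  by_cases hw : w ∈ subtreeVertices G r c
  · have hswap : Equiv.swap x y (branchRep G r c w) ∈ subtreeVertices G r c := by
      rw [Equiv.swap_apply_def]
      split_ifs
      exacts [hy, hx, (branchRep_mem_subtreeVertices_iff hG).2 hw]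
    rcases hS with hS | hS
    · exact iff_of_true (hS hswap) (hS hw)
    · exact iff_of_false (Set.disjoint_left.1 hS hswap) (Set.disjoint_left.1 hS hw)
  · rw [branchRep_eq_self_of_notMem hG hw, Equiv.swap_apply_of_ne_of_ne
      (ne_of_mem_of_not_mem hx hw).symm (ne_of_mem_of_not_mem hy hw).symm]

theorem subtreeVertices_subset_preimage_branchRep_or_subset_or_disjoint (hG : G.IsTree)
    (r c z : V) :
    (∃ v, subtreeVertices G r z ⊆ branchRep G r c ⁻¹' {v}) ∨
      subtreeVertices G r c ⊆ subtreeVertices G r z ∨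
      Disjoint (subtreeVertices G r c) (subtreeVertices G r z) := by
  by_cases hdisj : Disjoint (subtreeVertices G r c) (subtreeVertices G r z)
  · exact Or.inr (Or.inr hdisj)
  obtain ⟨w, hwc, hwz⟩ := Set.not_disjoint_iff.1 hdisj
  rcases mem_subtreeVertices_or_mem_of_mem_of_mem hG hwc hwz with hz | hc
  · obtain rfl | hne := eq_or_ne z c
    · exact Or.inr (Or.inl subset_rfl)
    · obtain ⟨g, hg, hzg⟩ := exists_isChild_of_mem_subtreeVertices hG hz hne
      exact Or.inl ⟨g, fun _ hw => branchRep_eq_of_mem hG hg (subtreeVertices_trans hG hzg hw)⟩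
  · exact Or.inr (Or.inl fun _ => subtreeVertices_trans hG hc)

end Branches

namespace Arrangement

section Hierarchical

variable {V : Type*} [Fintype V] {G : SimpleGraph V} {π : Arrangement V} {r c x y z : V}

/-- An arrangement is hierarchical for the tree `G` rooted at `r` if every subtree occupies
consecutive positions. -/
def IsHierarchical (G : SimpleGraph V) (r : V) (π : Arrangement V) : Prop :=
  ∀ x, π.IsBlock (subtreeVertices G r x)

theorem IsHierarchical.isBlock_preimage_branchRep (hG : G.IsTree) (h : π.IsHierarchical G r)
    (z : V) : π.IsBlock (branchRep G r c ⁻¹' {z}) := by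
  rcases preimage_branchRep_singleton hG z with hz | hz
  · rw [hz]
    exact h z
  · exact isBlock_of_subsingleton hz

/-- The arrangement obtained from `π` by exchanging the blocks represented by two of the
`branchRoots` of `c`. -/
noncomputable def swapBranches [DecidableEq V] (π : Arrangement V) (G : SimpleGraph V)
    (r c x y : V) : Arrangement V :=
  π.swapBlocks (branchRep G r c) x y

theorem IsHierarchical.swapBranches [DecidableEq V] (hG : G.IsTree) (h : π.IsHierarchical G r)
    (hx : x ∈ branchRoots G r c) (hy : y ∈ branchRoots G r c) :
    (π.swapBranches G r c x y).IsHierarchical G r := by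
  intro z
  rcases subtreeVertices_subset_preimage_branchRep_or_subset_or_disjoint hG r c z
    with ⟨v, hv⟩ | hz
  · exact (h z).swapBlocks_of_subset_fiber hv
  · exact (h z).swapBlocks_of_invariant fun _ =>
      swap_branchRep_mem_iff hG hz (branchRoots_subset_subtreeVertices hG hx)
        (branchRoots_subset_subtreeVertices hG hy)

theorem IsProjective.isHierarchical (hG : G.IsTree) (h : π.IsProjective G r) :
    π.IsHierarchical G r := by
  refine fun x => isBlock_iff.2 fun a ha b hb w hw haw => ?_
  by_contra hbw
  have hwb : π w < π b := (π.lt_or_lt_of_ne (ne_of_mem_of_not_mem hb hw)).resolve_left hbw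
  obtain ⟨p, hp⟩ := exists_walk_support_subset_subtreeVertices ha hb
  obtain ⟨s, hs, t, ht, hst, hsw, hwt⟩ :=
    exists_adj_mem_notMem_of_walk p (S := {v | π v < π w}) haw hwb.not_gt
  obtain ⟨q, hq⟩ := exists_walk_root_support_subset_compl_subtreeVertices hG hw
  have hwt' : π w < π t :=
    (π.lt_or_lt_of_ne (ne_of_mem_of_not_mem (hp t ht) hw)).resolve_left hwt
  obtain ⟨m, hm, n, hn, hmn, hmst, hnst⟩ := exists_adj_mem_notMem_of_walk q.reverse
    (S := {v | π s < π v ∧ π v < π t}) ⟨hsw, hwt'⟩ (h.2 s t hst)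
  rw [SimpleGraph.Walk.support_reverse, List.mem_reverse] at hm hn
  have hns := ne_of_mem_of_not_mem (hp s hs) (hq n hn)
  have hnt := ne_of_mem_of_not_mem (hp t ht) (hq n hn)
  rcases π.lt_or_lt_of_ne hns with hsn | hns
  · have htn := (π.lt_or_lt_of_ne hnt).resolve_right fun hnt => hnst ⟨hsn, hnt⟩
    exact h.1 s t m n hst hmn ⟨hmst.1, hmst.2, htn⟩
  · exact h.1 n m s t hmn.symm hst ⟨hns, hmst.1, hmst.2⟩

theorem IsHierarchical.isProjective (hG : G.IsTree) (h : π.IsHierarchical G r) :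
    π.IsProjective G r := by
  constructor
  · rintro s t u v hst huv ⟨hsu, hut, htv⟩
    obtain ⟨c, hc, hsc, htc, hctop⟩ := exists_upper_endpoint_of_adj hG r hst
    obtain ⟨d, hd, hud, hvd, hdtop⟩ := exists_upper_endpoint_of_adj hG r huv
    have hsu' := ne_of_apply_ne π hsu.ne
    have hut' := ne_of_apply_ne π hut.ne
    have htv' := ne_of_apply_ne π htv.ne
    have hsv' := ne_of_apply_ne π (hsu.trans (hut.trans htv)).ne
    have huc : u ∈ subtreeVertices G r c := (h c).mem_of_lt_of_lt hsc htc hsu hut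
    have htd : t ∈ subtreeVertices G r d := (h d).mem_of_lt_of_lt hud hvd hut htv
    have hdc : d ∈ subtreeVertices G r c := hdtop c (by grind) (by grind) (Or.inl huc)
    have hcd : c ∈ subtreeVertices G r d := hctop d (by grind) (by grind) (Or.inr htd)
    have heq := subtreeVertices_antisymm hG hdc hcd
    grind
  · rintro s t hst ⟨hsr, hrt⟩
    obtain ⟨c, hc, hsc, htc, -⟩ := exists_upper_endpoint_of_adj hG r hst
    obtain rfl := eq_of_root_mem_subtreeVertices ((h c).mem_of_lt_of_lt hsc htc hsr hrt)
    exact hc.elim (fun hcs => hsr.ne (hcs ▸ rfl)) fun hct => hrt.ne (hct ▸ rfl)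

theorem exists_isHierarchical_isFirst (hG : G.IsTree) (r : V) :
    ∃ π : Arrangement V, π.IsHierarchical G r ∧ π.IsFirst r := by
  let : LinearOrder V := LinearOrder.lift' (Fintype.equivFin V) (Fintype.equivFin V).injective
  choose p hp using fun w => (hG.existsUnique_path r w).exists
  have hmem {x w : V} : w ∈ subtreeVertices G r x ↔ (p x).support <+: (p w).support :=
    mem_subtreeVertices_iff_support_prefix hG (hp x) (hp w)
  have hinj : Function.Injective fun w => (p w).support :=
    fun v w (h : (p v).support = (p w).support) =>
      subtreeVertices_antisymm hG (hmem.2 (h ▸ List.prefix_rfl)) (hmem.2 (h ▸ List.prefix_rfl))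
  -- Sorting the vertices lexicographically by their paths from the root is depth-first order.
  refine ⟨sortBy _ hinj, fun x => ?_, fun w hw => ?_⟩
  · have hx : subtreeVertices G r x = (fun w => (p w).support) ⁻¹' {l | (p x).support <+: l} :=
      Set.ext fun w => hmem
    rw [hx]
    exact isBlock_sortBy (ordConnected_setOf_prefix _)
  · have hprefix := hmem.1 (mem_subtreeVertices_root hG r w)
    exact sortBy_lt_sortBy_iff.2 (lt_of_le_of_ne (not_lt.1 hprefix.le) (hinj.ne hw.symm))

theorem mem_projectiveArrangements_iff [DecidableEq V] (hG : G.IsTree) :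
    π ∈ projectiveArrangements G r ↔ π.IsHierarchical G r := by
  classical
  rw [projectiveArrangements, Finset.mem_filter_univ]
  exact ⟨IsProjective.isHierarchical hG, IsHierarchical.isProjective hG⟩

end Hierarchical

/-! ### Expected lengths from betweenness probabilities -/

section BetweenProb

variable {V : Type*} [Fintype V] {S : Finset (Arrangement V)} {a b m x y a' b' m' : V}

/-- The probability that `m` is placed strictly between `a` and `b` in a uniformly random
arrangement from `S`. -/
noncomputable def betweenProb (S : Finset (Arrangement V)) (a m b : V) : ℝ :=
  (Finset.card {π ∈ S | π.Between a m b} : ℝ) / S.card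

theorem betweenProb_congr (h : ∀ π ∈ S, π.Between a m b ↔ π.Between a' m' b') :
    betweenProb S a m b = betweenProb S a' m' b' := by
  rw [betweenProb, betweenProb, Finset.filter_congr h]

theorem betweenProb_comm (S : Finset (Arrangement V)) (a m b : V) :
    betweenProb S a m b = betweenProb S b m a :=
  betweenProb_congr fun _ _ => between_comm

theorem betweenProb_eq_zero (h : ∀ π ∈ S, ¬ π.Between a m b) : betweenProb S a m b = 0 := by
  rw [betweenProb, Finset.filter_false_of_mem h, Finset.card_empty, Nat.cast_zero, zero_div]

theorem card_between_add_card_between_add_card_between (S : Finset (Arrangement V))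
    (ham : a ≠ m) (hmb : m ≠ b) (hab : a ≠ b) :
    Finset.card {π ∈ S | π.Between a m b} + Finset.card {π ∈ S | π.Between m a b} +
      Finset.card {π ∈ S | π.Between a b m} = S.card := by
  simp only [Finset.card_filter, ← Finset.sum_add_distrib, Finset.card_eq_sum_ones S]
  refine Finset.sum_congr rfl fun π _ => ?_
  have ham := π.lt_or_lt_of_ne ham
  have hmb := π.lt_or_lt_of_ne hmb
  have hab := π.lt_or_lt_of_ne hab
  simp only [Between]
  grind

theorem betweenProb_add_add_eq_one (hS : S.Nonempty) (ham : a ≠ m) (hmb : m ≠ b)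
    (hab : a ≠ b) :
    betweenProb S a m b + betweenProb S m a b + betweenProb S a b m = 1 := by
  rw [betweenProb, betweenProb, betweenProb, ← add_div, ← add_div,
    div_eq_one_iff_eq (Nat.cast_ne_zero.2 hS.card_ne_zero)]
  exact_mod_cast card_between_add_card_between_add_card_between S ham hmb hab

theorem betweenProb_eq_one_half (hS : S.Nonempty) (hax : a ≠ x) (hay : a ≠ y) (hxy : x ≠ y)
    (h : betweenProb S a x y = betweenProb S a y x) (ha : ∀ π ∈ S, ¬ π.Between x a y) :
    betweenProb S a x y = 1 / 2 := by
  have hsum := betweenProb_add_add_eq_one hS hax hxy hay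
  rw [betweenProb_eq_zero ha, ← h] at hsum
  linarith

theorem uniformExpectation_edgeLength (hS : S.Nonempty) (h : a ≠ b) :
    uniformExpectation S (fun π => π.edgeLength a b) = 1 + ∑ m, betweenProb S a m b := by
  have hcard : (S.card : ℝ) ≠ 0 := Nat.cast_ne_zero.2 hS.card_ne_zero
  have hcomm : ∑ π ∈ S, (Finset.card {m | π.Between a m b} : ℝ) =
      ∑ m, (Finset.card {π ∈ S | π.Between a m b} : ℝ) := by
    simp only [Finset.card_filter, Nat.cast_sum]
    exact Finset.sum_comm
  simp only [uniformExpectation, edgeLength_eq_one_add_card_between _ h, betweenProb,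
    Finset.sum_add_distrib, hcomm, Finset.sum_const, nsmul_one, add_div, div_self hcard,
    Finset.sum_div]

end BetweenProb

section Symmetry

variable {V : Type*} [Fintype V] [DecidableEq V] {G : SimpleGraph V}
  {S : Finset (Arrangement V)} {r c f g x y a b m : V}

theorem betweenProb_swap (hG : G.IsTree) (hS : ∀ π ∈ S, π.IsHierarchical G r)
    (hx : x ∈ branchRoots G r c) (hy : y ∈ branchRoots G r c)
    (hswap : ∀ π ∈ S, π.swapBranches G r c x y ∈ S) (ha : branchRep G r c a = a)
    (hm : branchRep G r c m = m) (hb : branchRep G r c b = b) :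
    betweenProb S (Equiv.swap x y a) (Equiv.swap x y m) (Equiv.swap x y b) =
      betweenProb S a m b := by
  have hinv : ∀ π ∈ S, (π.swapBranches G r c x y).swapBranches G r c x y = π := fun π hπ =>
    swapBlocks_swapBlocks (branchRep_branchRep hG r c)
      ((hS π hπ).isBlock_preimage_branchRep hG) (branchRep_eq_self hG hx)
      (branchRep_eq_self hG hy)
  have hiff (π : Arrangement V) : (π.swapBranches G r c x y).Between a m b ↔
      π.Between (Equiv.swap x y a) (Equiv.swap x y m) (Equiv.swap x y b) :=
    swapBlocks_between_iff ha hm hb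
  rw [betweenProb, betweenProb]
  congr 2
  refine Finset.card_nbij' (fun π => π.swapBranches G r c x y)
    (fun π => π.swapBranches G r c x y) (fun π hπ => ?_) (fun π hπ => ?_)
    (fun π hπ => hinv π (Finset.mem_filter.1 hπ).1) fun π hπ => hinv π (Finset.mem_filter.1 hπ).1
  all_goals
    rw [Finset.mem_coe, Finset.mem_filter] at hπ ⊢
    refine ⟨hswap π hπ.1, ?_⟩
  · exact (hiff π).2 hπ.2
  · rw [← hiff, hinv π hπ.1]
    exact hπ.2

theorem betweenProb_swap_right (hG : G.IsTree) (hS : ∀ π ∈ S, π.IsHierarchical G r)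
    (hx : x ∈ branchRoots G r c) (hy : y ∈ branchRoots G r c)
    (hswap : ∀ π ∈ S, π.swapBranches G r c x y ∈ S) (ha : branchRep G r c a = a)
    (hax : a ≠ x) (hay : a ≠ y) : betweenProb S a x y = betweenProb S a y x := by
  have h := betweenProb_swap hG hS hx hy hswap ha (branchRep_eq_self hG hx)
    (branchRep_eq_self hG hy)
  rw [Equiv.swap_apply_of_ne_of_ne hax hay, Equiv.swap_apply_left, Equiv.swap_apply_right] at h
  exact h.symm

theorem betweenProb_child_eq_one_half (hG : G.IsTree) (hS : ∀ π ∈ S, π.IsHierarchical G r)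
    (hne : S.Nonempty) (ha : a ∉ subtreeVertices G r f) (hg : IsChild G r f g)
    (hswap : ∀ π ∈ S, π.swapBranches G r f g f ∈ S) : betweenProb S a g f = 1 / 2 := by
  have hf := self_mem_subtreeVertices hG r f
  have hag := (ne_of_mem_of_not_mem hg.2 ha).symm
  have haf := (ne_of_mem_of_not_mem hf ha).symm
  exact betweenProb_eq_one_half hne hag haf hg.ne.symm
    (betweenProb_swap_right hG hS (Or.inr hg) (Or.inl rfl) hswap
      (branchRep_eq_self_of_notMem hG ha) hag haf)
    fun π hπ => (hS π hπ f).not_between hg.2 hf ha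

theorem betweenProb_sibling_eq_one_half (hG : G.IsTree) (hS : ∀ π ∈ S, π.IsHierarchical G r)
    (hne : S.Nonempty) (hfirst : ∀ π ∈ S, π.IsFirst r) (hf : IsChild G r r f)
    (hg : IsChild G r r g) (hgf : g ≠ f) (hswap : ∀ π ∈ S, π.swapBranches G r r g f ∈ S) :
    betweenProb S r g f = 1 / 2 := by
  refine betweenProb_eq_one_half hne hg.ne hf.ne hgf
    (betweenProb_swap_right hG hS (Or.inr hg) (Or.inr hf) hswap
      (branchRep_eq_self hG (Or.inl rfl)) hg.ne hf.ne) fun π hπ hr => ?_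
  rcases hr with ⟨h, -⟩ | ⟨h, -⟩
  · exact (hfirst π hπ g hg.ne_root).not_gt h
  · exact (hfirst π hπ f hf.ne_root).not_gt h

theorem betweenProb_sibling_eq_one_third (hG : G.IsTree) (hS : ∀ π ∈ S, π.IsHierarchical G r)
    (hne : S.Nonempty) (hf : IsChild G r c f) (hg : IsChild G r c g) (hgf : g ≠ f)
    (hswap : ∀ x ∈ branchRoots G r c, ∀ y ∈ branchRoots G r c,
      ∀ π ∈ S, π.swapBranches G r c x y ∈ S) :
    betweenProb S c g f = 1 / 3 := by
  have hright {a x y : V} (ha : a ∈ branchRoots G r c) (hx : x ∈ branchRoots G r c)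
      (hy : y ∈ branchRoots G r c) (hax : a ≠ x) (hay : a ≠ y) :
      betweenProb S a x y = betweenProb S a y x :=
    betweenProb_swap_right hG hS hx hy (hswap x hx y hy) (branchRep_eq_self hG ha) hax hay
  have hc : c ∈ branchRoots G r c := Or.inl rfl
  have hswap_gf := hright hc (Or.inr hg) (Or.inr hf) hg.ne hf.ne
  have hswap_gc := hright (Or.inr hf) (Or.inr hg) hc hgf.symm hf.ne.symm
  rw [betweenProb_comm S f, betweenProb_comm S f] at hswap_gc
  have hsum := betweenProb_add_add_eq_one hne hg.ne hgf hf.ne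
  linarith

end Symmetry

section SubtreeSizes

variable {V : Type*} [Fintype V] {G : SimpleGraph V} {S : Finset (Arrangement V)}
  {r a b c f g w : V}

theorem betweenProb_eq_of_mem_subtreeVertices (hG : G.IsTree)
    (hS : ∀ π ∈ S, π.IsHierarchical G r) (hw : w ∈ subtreeVertices G r g)
    (ha : a ∉ subtreeVertices G r g) (hb : b ∉ subtreeVertices G r g) :
    betweenProb S a w b = betweenProb S a g b :=
  betweenProb_congr fun π hπ =>
    (hS π hπ g).between_iff hw (self_mem_subtreeVertices hG r g) ha hb

theorem betweenProb_self_left (S : Finset (Arrangement V)) (a b : V) :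
    betweenProb S a a b = 0 :=
  betweenProb_eq_zero fun _ _ h => h.elim (fun h => h.1.false) fun h => h.2.false

theorem betweenProb_of_isChild (hG : G.IsTree) (hS : ∀ π ∈ S, π.IsHierarchical G r)
    (hf : IsChild G r c f) {p q : ℝ} (hbelow : ∀ g, IsChild G r f g → betweenProb S c g f = p)
    (hbeside : ∀ g, IsChild G r c g → g ≠ f → betweenProb S c g f = q) (w : V) :
    betweenProb S c w f = (subtreeVertices G r f \ {f}).indicator (fun _ => p) w +
      (subtreeVertices G r c \ insert c (subtreeVertices G r f)).indicator (fun _ => q) w := by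
  have hcf := hf.notMem_subtreeVertices hG
  have hff := self_mem_subtreeVertices hG r f
  by_cases hwf : w ∈ subtreeVertices G r f
  · obtain rfl | hne := eq_or_ne w f
    · simp [betweenProb_comm S c, betweenProb_self_left, hwf]
    · obtain ⟨g, hg, hwg⟩ := exists_isChild_of_mem_subtreeVertices hG hwf hne
      rw [betweenProb_eq_of_mem_subtreeVertices hG hS hwg
        (fun hc => hcf (subtreeVertices_trans hG hg.2 hc)) (hg.notMem_subtreeVertices hG),
        hbelow g hg]
      simp [hwf, hne]
  · obtain rfl | hne := eq_or_ne w c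
    · simp [betweenProb_self_left, hwf]
    · by_cases hwc : w ∈ subtreeVertices G r c
      · obtain ⟨g, hg, hwg⟩ := exists_isChild_of_mem_subtreeVertices hG hwc hne
        have hgf : g ≠ f := fun h => hwf (h ▸ hwg)
        rw [betweenProb_eq_of_mem_subtreeVertices hG hS hwg (hg.notMem_subtreeVertices hG)
          (Set.disjoint_right.1 (hg.disjoint_subtreeVertices hG hf hgf) hff), hbeside g hg hgf]
        simp [hwf, hwc, hne]
      · rw [betweenProb_eq_zero fun π hπ =>
          (hS π hπ c).not_between (self_mem_subtreeVertices hG r c) hf.2 hwc]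
        simp [hwf, hwc]

theorem uniformExpectation_edgeLength_of_isChild (hG : G.IsTree)
    (hS : ∀ π ∈ S, π.IsHierarchical G r) (hne : S.Nonempty) (hf : IsChild G r c f) {p q : ℝ}
    (hbelow : ∀ g, IsChild G r f g → betweenProb S c g f = p)
    (hbeside : ∀ g, IsChild G r c g → g ≠ f → betweenProb S c g f = q) :
    uniformExpectation S (fun π => π.edgeLength c f) =
      1 + (directionalSize G r f - 1) * p +
        (directionalSize G r c - directionalSize G r f - 1) * q := by
  classical
  have hsum (A : Set V) (t : ℝ) : ∑ w, A.indicator (fun _ => t) w = A.ncard * t := by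
    rw [Finset.sum_indicator_eq_sum_filter, Finset.sum_const, nsmul_eq_mul,
      Set.ncard_eq_toFinset_card', Set.filter_mem_univ_eq_toFinset]
  have hbelow_card : ((subtreeVertices G r f \ {f}).ncard : ℝ) + 1 = directionalSize G r f := by
    exact_mod_cast Set.ncard_sdiff_singleton_add_one (self_mem_subtreeVertices hG r f)
  have hbeside_card : ((subtreeVertices G r c \ insert c (subtreeVertices G r f)).ncard : ℝ) +
      (directionalSize G r f + 1) = directionalSize G r c := by
    rw [directionalSize, directionalSize, ← Nat.cast_add_one,
      ← Set.ncard_insert_of_notMem (hf.notMem_subtreeVertices hG)]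
    exact_mod_cast Set.ncard_sdiff_add_ncard_of_subset (Set.insert_subset
      (self_mem_subtreeVertices hG r c) fun _ => subtreeVertices_trans hG hf.2)
  rw [uniformExpectation_edgeLength hne hf.ne,
    Finset.sum_congr rfl fun w _ => betweenProb_of_isChild hG hS hf hbelow hbeside w,
    Finset.sum_add_distrib, hsum, hsum, ← hbeside_card, ← hbelow_card]
  ring

theorem uniformExpectation_edgeLength_of_swapBranches_mem [DecidableEq V] (hG : G.IsTree)
    (hS : ∀ π ∈ S, π.IsHierarchical G r) (hne : S.Nonempty) (hf : IsChild G r c f)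
    (hswap : ∀ z ∈ subtreeVertices G r c, ∀ x ∈ branchRoots G r z, ∀ y ∈ branchRoots G r z,
      ∀ π ∈ S, π.swapBranches G r z x y ∈ S) :
    uniformExpectation S (fun π => π.edgeLength c f) =
      (2 * directionalSize G r c + directionalSize G r f + 1) / 6 := by
  rw [uniformExpectation_edgeLength_of_isChild hG hS hne hf
    (fun g hg => betweenProb_child_eq_one_half hG hS hne (hf.notMem_subtreeVertices hG) hg
      (hswap f hf.2 g (Or.inr hg) f (Or.inl rfl)))
    (fun g hg hgf => betweenProb_sibling_eq_one_third hG hS hne hf hg hgf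
      (hswap c (self_mem_subtreeVertices hG r c)))]
  ring

theorem expectedLengthProjective_of_isChild [DecidableEq V] (hG : G.IsTree)
    (hf : IsChild G r c f) : expectedLengthProjective G r c f =
      (2 * directionalSize G r c + directionalSize G r f + 1) / 6 := by
  refine uniformExpectation_edgeLength_of_swapBranches_mem hG
    (fun π => (mem_projectiveArrangements_iff hG).1) ?_ hf fun z _ x hx y hy π hπ => ?_
  · obtain ⟨π, hπ, -⟩ := exists_isHierarchical_isFirst hG r
    exact ⟨π, (mem_projectiveArrangements_iff hG).2 hπ⟩
  · rw [mem_projectiveArrangements_iff hG] at hπ ⊢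
    exact hπ.swapBranches hG hx hy

theorem expectedLengthProjective_comm [DecidableEq V] (G : SimpleGraph V) (r u v : V) :
    expectedLengthProjective G r u v = expectedLengthProjective G r v u := by
  simp only [expectedLengthProjective, edgeLength_comm]

end SubtreeSizes

/-! ### Rotating planar arrangements -/

section Rotation

variable {V : Type*} [Fintype V] {G : SimpleGraph V} {π : Arrangement V} {r v w : V}

/-- The cyclic rotation of the arrangement `π` that brings the vertex `r` to the front. -/
def rotateTo (π : Arrangement V) (r : V) : Arrangement V :=
  haveI : NeZero (Fintype.card V) := ⟨(Fintype.card_pos_iff.2 ⟨r⟩).ne'⟩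
  π.trans (Equiv.subRight (π r))

theorem rotateTo_apply : π.rotateTo r v = π v - π r := rfl

theorem rotateTo_lt_rotateTo_iff : π.rotateTo r v < π.rotateTo r w ↔
    π v < π w ∧ (π r ≤ π v ∨ π w < π r) ∨ π r ≤ π v ∧ π w < π r := by
  have hv := (π v).isLt
  have hw := (π w).isLt
  rw [rotateTo_apply, rotateTo_apply, Fin.lt_def]
  rcases le_or_gt (π r) (π v) with hrv | hrv <;> rcases le_or_gt (π r) (π w) with hrw | hrw
  all_goals
    first | rw [Fin.coe_sub_iff_le.2 hrv] | rw [Fin.coe_sub_iff_lt.2 hrv]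
    first | rw [Fin.coe_sub_iff_le.2 hrw] | rw [Fin.coe_sub_iff_lt.2 hrw]
    rw [Fin.lt_def, Fin.lt_def, Fin.le_def] at *
    omega

theorem isFirst_rotateTo (π : Arrangement V) (r : V) : (π.rotateTo r).IsFirst r := by
  intro w hw
  rw [rotateTo_lt_rotateTo_iff]
  rcases π.lt_or_lt_of_ne hw with h | h
  · exact Or.inr ⟨le_rfl, h⟩
  · exact Or.inl ⟨h, Or.inl le_rfl⟩

theorem IsFirst.rotateTo_rotateTo (h : π.IsFirst r) (s : V) : (π.rotateTo s).rotateTo r = π := by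
  have : NeZero (Fintype.card V) := ⟨(Fintype.card_pos_iff.2 ⟨r⟩).ne'⟩
  refine Equiv.ext fun v => ?_
  rw [rotateTo_apply, rotateTo_apply, rotateTo_apply, isFirst_iff_eq_zero.1 h,
    sub_sub_sub_cancel_right, sub_zero]

theorem IsPlanar.rotateTo (h : π.IsPlanar G) (r : V) : (π.rotateTo r).IsPlanar G := by
  -- Whether two edges cross depends only on the cyclic order of their endpoints.
  rintro s t u v hst huv hcross
  simp only [rotateTo_lt_rotateTo_iff] at hcross
  have hstuv := h s t u v hst huv
  have huvts := h u v t s huv hst.symm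
  have htsvu := h t s v u hst.symm huv.symm
  have hvust := h v u s t huv.symm hst
  grind

end Rotation

section RootFirst

variable {V : Type*} [Fintype V] [DecidableEq V] {G : SimpleGraph V} {π : Arrangement V}
  {r c f u v : V}

open Classical in
/-- The planar arrangements of `G` in which `r` comes first. -/
noncomputable def rootFirstArrangements (G : SimpleGraph V) (r : V) : Finset (Arrangement V) :=
  {π ∈ planarArrangements G | π.IsFirst r}

theorem mem_rootFirstArrangements_iff :
    π ∈ rootFirstArrangements G r ↔ π.IsPlanar G ∧ π.IsFirst r := by
  classical
  rw [rootFirstArrangements, planarArrangements, Finset.mem_filter, Finset.mem_filter_univ]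

theorem mem_rootFirstArrangements_iff_isHierarchical (hG : G.IsTree) :
    π ∈ rootFirstArrangements G r ↔ π.IsHierarchical G r ∧ π.IsFirst r := by
  rw [mem_rootFirstArrangements_iff]
  refine and_congr_left fun hfirst => ⟨fun h => ?_, fun h => (h.isProjective hG).1⟩
  refine IsProjective.isHierarchical hG ⟨h, fun s t _ hcover => ?_⟩
  exact (hfirst s (ne_of_apply_ne π hcover.1.ne)).not_gt hcover.1

theorem rootFirstArrangements_nonempty (hG : G.IsTree) (r : V) :
    (rootFirstArrangements G r).Nonempty :=
  let ⟨π, hπ⟩ := exists_isHierarchical_isFirst hG r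
  ⟨π, (mem_rootFirstArrangements_iff_isHierarchical hG).2 hπ⟩

theorem card_rootFirstArrangements (G : SimpleGraph V) (r s : V) :
    (rootFirstArrangements G r).card = (rootFirstArrangements G s).card := by
  have hmaps (r s : V) : ∀ π ∈ rootFirstArrangements G r,
      π.rotateTo s ∈ rootFirstArrangements G s :=
    fun π hπ => mem_rootFirstArrangements_iff.2
      ⟨(mem_rootFirstArrangements_iff.1 hπ).1.rotateTo s, π.isFirst_rotateTo s⟩
  exact Finset.card_nbij' (rotateTo · s) (rotateTo · r) (hmaps r s) (hmaps s r)
    (fun π hπ => (mem_rootFirstArrangements_iff.1 hπ).2.rotateTo_rotateTo s)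
    fun π hπ => (mem_rootFirstArrangements_iff.1 hπ).2.rotateTo_rotateTo r

theorem sum_planarArrangements {M : Type*} [AddCommMonoid M] [Nonempty V] (G : SimpleGraph V)
    (X : Arrangement V → M) :
    ∑ π ∈ planarArrangements G, X π = ∑ r, ∑ π ∈ rootFirstArrangements G r, X π := by
  classical
  have : NeZero (Fintype.card V) := ⟨Fintype.card_ne_zero⟩
  rw [← Finset.sum_fiberwise (planarArrangements G) (fun π => π.symm 0) X]
  refine Finset.sum_congr rfl fun r _ => Finset.sum_congr (Finset.filter_congr fun π _ => ?_)
    fun _ _ => rfl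
  rw [isFirst_iff_eq_zero, Equiv.symm_apply_eq, eq_comm]

theorem uniformExpectation_planarArrangements [Nonempty V] (G : SimpleGraph V)
    (X : Arrangement V → ℝ) : uniformExpectation (planarArrangements G) X =
      (1 / Fintype.card V) * ∑ r, uniformExpectation (rootFirstArrangements G r) X := by
  obtain ⟨s⟩ := ‹Nonempty V›
  have hcard : (planarArrangements G).card =
      Fintype.card V * (rootFirstArrangements G s).card := by
    rw [Finset.card_eq_sum_ones, sum_planarArrangements]
    simp only [card_rootFirstArrangements G _ s, Finset.sum_const, Finset.card_univ, smul_eq_mul,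
      mul_one]
  simp only [uniformExpectation, sum_planarArrangements, hcard, card_rootFirstArrangements G _ s,
    Nat.cast_mul, ← Finset.sum_div]
  rw [one_div_mul_eq_div, div_div, mul_comm]

theorem swapBranches_mem_rootFirstArrangements (hG : G.IsTree) {x y : V}
    (hx : x ∈ branchRoots G r c) (hy : y ∈ branchRoots G r c) (hxr : x ≠ r) (hyr : y ≠ r)
    (hπ : π ∈ rootFirstArrangements G r) :
    π.swapBranches G r c x y ∈ rootFirstArrangements G r := by
  rw [mem_rootFirstArrangements_iff_isHierarchical hG] at hπ ⊢
  exact ⟨hπ.1.swapBranches hG hx hy, hπ.2.swapBlocks (fun _ => branchRep_eq_root_iff) hxr hyr⟩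

theorem uniformExpectation_rootFirstArrangements_of_ne_root (hG : G.IsTree)
    (hf : IsChild G r c f) (hc : c ≠ r) :
    uniformExpectation (rootFirstArrangements G r) (fun π => π.edgeLength c f) =
      expectedLengthProjective G r c f := by
  rw [expectedLengthProjective_of_isChild hG hf]
  refine uniformExpectation_edgeLength_of_swapBranches_mem hG
    (fun π hπ => ((mem_rootFirstArrangements_iff_isHierarchical hG).1 hπ).1)
    (rootFirstArrangements_nonempty hG r) hf fun z hz x hx y hy π hπ => ?_
  have hzr : z ≠ r := fun h => hc (eq_of_root_mem_subtreeVertices (h ▸ hz))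
  exact swapBranches_mem_rootFirstArrangements hG hx hy (ne_root_of_mem_branchRoots hG hx hzr)
    (ne_root_of_mem_branchRoots hG hy hzr) hπ

theorem uniformExpectation_rootFirstArrangements_of_ne_of_ne (hG : G.IsTree) (huv : G.Adj u v)
    (hu : u ≠ r) (hv : v ≠ r) :
    uniformExpectation (rootFirstArrangements G r) (fun π => π.edgeLength u v) =
      expectedLengthProjective G r u v := by
  rcases isChild_or_isChild_of_adj hG r huv with h | h
  · exact uniformExpectation_rootFirstArrangements_of_ne_root hG h hu
  · simp only [edgeLength_comm _ u v, expectedLengthProjective_comm G r u v]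
    exact uniformExpectation_rootFirstArrangements_of_ne_root hG h hv

theorem uniformExpectation_rootFirstArrangements_root (hG : G.IsTree) (h : G.Adj r f) :
    uniformExpectation (rootFirstArrangements G r) (fun π => π.edgeLength r f) =
      Fintype.card V / 2 := by
  have hf : IsChild G r r f := ⟨h, mem_subtreeVertices_root hG r f⟩
  have hmem := fun π (hπ : π ∈ rootFirstArrangements G r) =>
    (mem_rootFirstArrangements_iff_isHierarchical hG).1 hπ
  have hne := rootFirstArrangements_nonempty hG r
  rw [uniformExpectation_edgeLength_of_isChild hG (fun π hπ => (hmem π hπ).1) hne hf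
    (fun g hg => betweenProb_child_eq_one_half hG (fun π hπ => (hmem π hπ).1) hne
      (hf.notMem_subtreeVertices hG) hg fun π =>
        swapBranches_mem_rootFirstArrangements hG (Or.inr hg) (Or.inl rfl) hg.ne_root hf.ne_root)
    (fun g hg hgf => betweenProb_sibling_eq_one_half hG (fun π hπ => (hmem π hπ).1) hne
      (fun π hπ => (hmem π hπ).2) hf hg hgf fun π =>
        swapBranches_mem_rootFirstArrangements hG (Or.inr hg) (Or.inr hf) hg.ne_root hf.ne_root),
    directionalSize_root hG]
  ring

theorem expectedLengthPlanar_eq (hG : G.IsTree) (huv : G.Adj u v) :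
    expectedLengthPlanar G u v = 1 + (1 / (Fintype.card V : ℝ)) *
      ∑ r ∈ Finset.univ \ {u, v}, expectedLengthProjective G r u v := by
  have : Nonempty V := ⟨u⟩
  have hcard : (Fintype.card V : ℝ) ≠ 0 := Nat.cast_ne_zero.2 Fintype.card_ne_zero
  have hroots : ∑ r ∈ {u, v}, uniformExpectation (rootFirstArrangements G r)
      (fun π => π.edgeLength u v) = Fintype.card V := by
    rw [Finset.sum_pair huv.ne, uniformExpectation_rootFirstArrangements_root hG huv]
    simp only [edgeLength_comm _ u v]
    rw [uniformExpectation_rootFirstArrangements_root hG huv.symm, add_halves]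
  have hrest : ∀ r ∈ Finset.univ \ {u, v}, uniformExpectation (rootFirstArrangements G r)
      (fun π => π.edgeLength u v) = expectedLengthProjective G r u v := by
    intro r hr
    rw [Finset.mem_sdiff, Finset.mem_insert, Finset.mem_singleton, not_or] at hr
    exact uniformExpectation_rootFirstArrangements_of_ne_of_ne hG huv (Ne.symm hr.2.1)
      (Ne.symm hr.2.2)
  rw [expectedLengthPlanar, uniformExpectation_planarArrangements,
    ← Finset.sum_sdiff (Finset.subset_univ {u, v}), hroots, Finset.sum_congr rfl hrest, mul_add,
    one_div_mul_cancel hcard, add_comm]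

end RootFirst

end Arrangement

theorem mainTheorem4 {V : Type*} [Fintype V] [DecidableEq V] (G : SimpleGraph V)
    (hG : G.IsTree) (u v : V) (huv : G.Adj u v) :
    expectedLengthPlanar G u v =
        1 + (1 / (Fintype.card V : ℝ)) *
          ∑ r ∈ Finset.univ \ {u, v}, expectedLengthProjective G r u v ∧
      ∀ r : V, expectedLengthProjective G r u v =
        (2 * (directionalSize G r (closestEndpoint G r u v) : ℝ) +
          (directionalSize G r (farthestEndpoint G r u v) : ℝ) + 1) / 6 := by
  refine ⟨Arrangement.expectedLengthPlanar_eq hG huv, fun r => ?_⟩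
  have hchild := isChild_closestEndpoint_farthestEndpoint hG r huv
  rw [← Arrangement.expectedLengthProjective_of_isChild hG hchild, closestEndpoint,
    farthestEndpoint]
  split_ifs
  · rfl
  · exact Arrangement.expectedLengthProjective_comm G r u v
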